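/- Let $G=(V,E)$ be a ribbon graph with finitely many vertices and edges (possibly disconnected, possibly non-orientable), that is, a surface with boundary represented as a union of a set $V$ of disjoint discs (vertices) and a set $E$ of disjoint discs (edges), where vertices and edges meet in disjoint line segments, each lying on the boundary of precisely one vertex and precisely one edge, and every edge contains exactly two of these segments; ribbon graphs are considered up to homeomorphisms preserving this structure, so that $G$ is described by a signed rotation system. For $A\subseteq E$ let $f(A)$ be the number of boundary components of the spanning ribbon subgraph $(V,A)$, and let $k(A)$ be its number of connected components; put $k(G)=k(E)$. For an integer $n\ge 0$ the $n$-spread $D_{\le n}(G)$ and the $n$-toggle $D_n(G)$ are the set systems with ground set $E$ and families of feasible sets $$\mathcal F_{\le n}(G)=\{A\subseteq E : f(A)\le k(G)+n\},\qquad \mathcal F_n(G)=\{A\subseteq E : f(A)=k(G)+n\}.$$ A delta-matroid is a pair $(E,\mathcal F)$ with $E$ a finite set and $\mathcal F$ a non-empty family of subsets of $E$ such that for all $X,Y\in\mathcal F$ and every $u\in X\bigtriangleup Y$ there is $v\in X\bigtriangleup Y$ (possibly $v=u$) with $X\bigtriangleup\{u,v\}\in\mathcal F$. Then: 1. for every $n\ge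 0$, $D_{\le n}(G)$ is a delta-matroid; 2. if $G$ has at least one edge and is orientable (as a surface), then $D_1(G)$ is a delta-matroid; 3. the feasible sets of $D_{\le 0}(G)$ are exactly the edge sets $A$ of the spanning quasi-trees of $G$, i.e. those $A$ for which $k(A)=k(G)$ and every connected component of $(V,A)$ has exactly one boundary component; in particular, by 1, the edge sets of the spanning quasi-trees of $G$ are the feasible sets of a delta-matroid. -/

import Mathlib

open scoped symmDiff

/-- A set system `(E, 𝓕)`; the ground set is the type `E`. -/
structure SetSystem (E : Type*) where
  /-- The feasible sets. -/
  Feasible : Set (Set E)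

/-- A delta-matroid: a proper set system on a finite ground set that satisfies the
Symmetric Exchange Axiom (in which `v = u` is allowed). -/
structure SetSystem.IsDeltaMatroid {E : Type*} (D : SetSystem E) : Prop where
  finite : Finite E
  proper : D.Feasible.Nonempty
  exchange : ∀ X ∈ D.Feasible, ∀ Y ∈ D.Feasible, ∀ u ∈ X ∆ Y,
    ∃ v ∈ X ∆ Y, X ∆ {u, v} ∈ D.Feasible

/-- A (not necessarily orientable, not necessarily connected) ribbon graph with vertex discs `V`
and edge discs `E`, given by its signed rotation system.

The edge disc `e` meets the vertex discs in two line segments, the half-edges `(e, false)` and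
`(e, true)`.  An orientation is chosen on the boundary circle of every vertex disc; `next h` is the
half-edge that follows `h` on that circle, so that the half-edges on one vertex disc form exactly
one cycle of `next`.  A vertex disc may carry no half-edge at all.  The ribbon `e` is `twisted` if
it does not respect the chosen orientations at its two ends. -/
structure RibbonGraph (V E : Type*) where
  /-- The vertex disc on whose boundary the half-edge lies. -/
  vert : E × Bool → V
  /-- The rotation: the next half-edge around the vertex disc. -/
  next : Equiv.Perm (E × Bool)
  /-- The half-edges on one vertex disc form a single cycle of the rotation. -/
  vert_eq_iff : ∀ h h' : E × Bool, vert h = vert h' ↔ next.SameCycle h h'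
  /-- Whether the ribbon has a half-twist. -/
  twisted : E → Bool

namespace RibbonGraph

variable {V E : Type*} (G : RibbonGraph V E)

/-- Two vertex discs are joined by an edge disc in `A`. -/
def JoinedBy (A : Set E) (u v : V) : Prop :=
  ∃ e ∈ A, G.vert (e, false) = u ∧ G.vert (e, true) = v

/-- The connected components of the spanning ribbon subgraph `(V, A)`. -/
def Component (A : Set E) : Type _ := Quot (G.JoinedBy A)

/-- `k(A)`: the number of connected components of `(V, A)`. -/
noncomputable def numComponents (A : Set E) : ℕ := Nat.card (G.Component A)

/-- Marked points on the boundaries of the discs.  The corners are the end points of the line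
segments in which the discs meet: with respect to the orientation of the vertex disc, the segment
`h` runs from `(h, false)` to `(h, true)`.  In addition, one point is marked on the boundary
circle of every vertex disc that carries no segment. -/
abbrev BoundaryPoint : Type _ := ((E × Bool) × Bool) ⊕ {v : V // ∀ h, G.vert h ≠ v}

/-- The vertex disc on which a marked point lies. -/
def BoundaryPoint.vertex : G.BoundaryPoint → V
  | Sum.inl (h, _) => G.vert h
  | Sum.inr v => v.1

/-- The arcs between corners that make up the boundary of the surface `(V, A)`, that is, of the
union of all vertex discs with the edge discs in `A`. -/
inductive BoundaryArc (A : Set E) : G.BoundaryPoint → G.BoundaryPoint → Prop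
  /-- The arc of a vertex circle from the end of a segment to the start of the next one. -/
  | gap (h : E × Bool) :
      BoundaryArc A (Sum.inl (h, true)) (Sum.inl (G.next h, false))
  /-- A segment at which the edge disc has been removed. -/
  | segment (h : E × Bool) (hA : h.1 ∉ A) :
      BoundaryArc A (Sum.inl (h, false)) (Sum.inl (h, true))
  /-- A side of an edge disc in `A`: an untwisted ribbon joins the start of each of its segments
  to the end of the other one, a twisted ribbon joins start to start and end to end. -/
  | side (e : E) (b : Bool) (hA : e ∈ A) :
      BoundaryArc A (Sum.inl ((e, false), b))
        (Sum.inl ((e, true), if G.twisted e then b else !b))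

/-- The boundary components of the surface `(V, A)`. -/
def BoundaryComponent (A : Set E) : Type _ := Quot (G.BoundaryArc A)

/-- `f(A)`: the number of boundary components of `(V, A)`. -/
noncomputable def numBoundary (A : Set E) : ℕ := Nat.card (G.BoundaryComponent A)

/-- The boundary component `b` of `(V, A)` lies on the connected component `c` of `(V, A)`. -/
def LiesOn (A : Set E) (b : G.BoundaryComponent A) (c : G.Component A) : Prop :=
  ∃ p : G.BoundaryPoint, Quot.mk _ p = b ∧ Quot.mk _ (BoundaryPoint.vertex G p) = c

/-- `(V, A)` is a spanning quasi-tree of `G`: it has as many connected components as `G`, and each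
of them has exactly one boundary component. -/
def IsSpanningQuasiTree (A : Set E) : Prop :=
  G.numComponents A = G.numComponents Set.univ ∧
    ∀ c : G.Component A, ∃! b : G.BoundaryComponent A, G.LiesOn A b c

/-- `G` is orientable: after reversing the orientations of some vertex discs (those with
`r v = true`), every ribbon respects the orientations at its two ends.  Reversing a vertex disc
changes the twist of a ribbon once for each of its ends on that disc. -/
def Orientable : Prop :=
  ∃ r : V → Bool, ∀ e : E,
    xor (G.twisted e) (xor (r (G.vert (e, false))) (r (G.vert (e, true)))) = false

/-- The `n`-spread `D_{≤ n}(G)`. -/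
def spread (n : ℕ) : SetSystem E where
  Feasible := {A | G.numBoundary A ≤ G.numComponents Set.univ + n}

/-- The `n`-toggle `D_n(G)`. -/
def toggle (n : ℕ) : SetSystem E where
  Feasible := {A | G.numBoundary A = G.numComponents Set.univ + n}

end RibbonGraph

/-! Boundary components are traced by alternating two fixed-point-free involutions on corners: gaps
of vertex circles, and segments or ribbon sides. Toggling an edge `e` re-pairs only its four
corners, so `f` changes by at most one (`numBoundary_le_toggle_add_one`), and `f` drops unless those
corners share one component (`numBoundary_toggle_lt`). If no edge of `X ∆ Y` lowers `f(X)`, every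
component of `Y` lies in one of `X`, whence `f(X) ≤ f(Y)`. So `f(Y) < f(X)` yields an edge of `X ∆
Y` lowering `f(X)`, which gives exchange for spreads. A minimiser of `f` reaches `k(G)`. For
orientable `G` every toggle changes `f` by exactly one, and the same exchange works at level `k(G) +
1`. -/

theorem Finset.even_card_of_involution {α : Type*} (s : Finset α) (i : α → α)
    (hi : ∀ x ∈ s, i x ∈ s) (hii : ∀ x ∈ s, i (i x) = x) (hne : ∀ x ∈ s, i x ≠ x) :
    Even s.card := by
  have h : ∑ _x ∈ s, (1 : ZMod 2) = 0 :=
    Finset.sum_involution (fun x _ => i x) (fun _ _ => by decide) (fun x hx _ => hne x hx)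
      (fun x hx => hi x hx) (fun x hx => hii x hx)
  rw [Finset.sum_const, nsmul_one] at h
  exact (ZMod.natCast_eq_zero_iff_even).1 h

/-! ### Boundary arcs as involutions on corners -/

namespace RibbonGraph

variable {V E : Type*} (G : RibbonGraph V E)

theorem vert_next (h : E × Bool) : G.vert (G.next h) = G.vert h :=
  (G.vert_eq_iff _ _).2 (Equiv.Perm.SameCycle.refl _ _ |>.apply_left)

/-- The corner at the other end of the gap of a vertex circle that starts or ends at a corner. -/
def gapPartner : (E × Bool) × Bool → (E × Bool) × Bool
  | (h, true) => (G.next h, false)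
  | (h, false) => (G.next.symm h, true)

open Classical in
/-- The corner joined to a given one by a segment or by the side of an edge disc in the boundary
of `(V, A)`. -/
noncomputable def edgePartner (A : Set E) (x : (E × Bool) × Bool) : (E × Bool) × Bool :=
  if x.1.1 ∈ A then ((x.1.1, !x.1.2), if G.twisted x.1.1 then x.2 else !x.2) else (x.1, !x.2)

/-- The boundary component of `(V, A)` that passes through a corner. -/
def cornerComponent (A : Set E) (x : (E × Bool) × Bool) : G.BoundaryComponent A :=
  Quot.mk _ (Sum.inl x)

theorem gapPartner_gapPartner (x : (E × Bool) × Bool) : G.gapPartner (G.gapPartner x) = x := by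
  rcases x with ⟨h, _ | _⟩ <;> simp [gapPartner]

theorem gapPartner_snd (x : (E × Bool) × Bool) : (G.gapPartner x).2 = !x.2 := by
  rcases x with ⟨h, _ | _⟩ <;> rfl

theorem gapPartner_ne (x : (E × Bool) × Bool) : G.gapPartner x ≠ x := fun h => by
  have := G.gapPartner_snd x
  rw [h] at this
  simp at this

theorem vert_gapPartner (x : (E × Bool) × Bool) : G.vert (G.gapPartner x).1 = G.vert x.1 := by
  rcases x with ⟨h, _ | _⟩
  · have := G.vert_next (G.next.symm h)
    simpa [gapPartner] using this.symm
  · exact G.vert_next h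

theorem edgePartner_edge (A : Set E) (x : (E × Bool) × Bool) :
    (G.edgePartner A x).1.1 = x.1.1 := by
  unfold edgePartner
  split_ifs <;> rfl

theorem edgePartner_edgePartner (A : Set E) (x : (E × Bool) × Bool) :
    G.edgePartner A (G.edgePartner A x) = x := by
  rcases x with ⟨⟨e, s⟩, b⟩
  by_cases h : e ∈ A <;> by_cases t : G.twisted e <;> simp [edgePartner, h, t]

theorem edgePartner_ne (A : Set E) (x : (E × Bool) × Bool) : G.edgePartner A x ≠ x := by
  rcases x with ⟨⟨e, s⟩, b⟩
  by_cases h : e ∈ A <;> simp [edgePartner, h]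

theorem edgePartner_congr {A B : Set E} {x : (E × Bool) × Bool} (h : x.1.1 ∈ A ↔ x.1.1 ∈ B) :
    G.edgePartner A x = G.edgePartner B x := by
  by_cases hA : x.1.1 ∈ A
  · simp only [edgePartner, hA, h.1 hA, if_true]
  · simp only [edgePartner, hA, mt h.2 hA, if_false]

theorem mem_toggle_iff {A : Set E} {e e' : E} (h : e' ≠ e) : e' ∈ A ↔ e' ∈ A ∆ {e} := by
  simp [Set.mem_symmDiff, h]

theorem toggle_toggle_of_ne (X : Set E) {u v : E} (h : v ≠ u) :
    (X ∆ {u}) ∆ {v} = X ∆ {u, v} := by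
  rw [symmDiff_assoc, (Set.disjoint_singleton.2 h.symm).symmDiff_eq_sup]
  rfl

theorem mem_symmDiff_of_mem_toggle_symmDiff {X Y : Set E} {u v : E} (hu : u ∈ X ∆ Y)
    (hv : v ∈ (X ∆ {u}) ∆ Y) : v ∈ X ∆ Y ∧ v ≠ u := by
  simp only [Set.mem_symmDiff, Set.mem_singleton_iff] at hu hv ⊢
  by_cases h : v = u
  · subst h
    tauto
  · tauto

theorem edgePartner_toggle_of_ne {A : Set E} {e : E} {x : (E × Bool) × Bool} (h : x.1.1 ≠ e) :
    G.edgePartner (A ∆ {e}) x = G.edgePartner A x :=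
  G.edgePartner_congr (mem_toggle_iff h).symm

theorem edgePartner_toggle_ne {A : Set E} {e : E} {x : (E × Bool) × Bool} (h : x.1.1 = e) :
    G.edgePartner (A ∆ {e}) x ≠ G.edgePartner A x := by
  subst h
  rcases x with ⟨⟨e, s⟩, b⟩
  by_cases h : e ∈ A <;> simp [edgePartner, Set.mem_symmDiff, h]

/-- The four corners of an edge disc, in terms of the arcs before and after toggling the edge. -/
theorem corner_cases (A : Set E) {e : E} {x y : (E × Bool) × Bool} (hx : x.1.1 = e)
    (hy : y.1.1 = e) : y = x ∨ y = G.edgePartner A x ∨ y = G.edgePartner (A ∆ {e}) x ∨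
      y = G.edgePartner A (G.edgePartner (A ∆ {e}) x) := by
  rcases x with ⟨⟨e', s⟩, b⟩
  rcases y with ⟨⟨e'', s'⟩, b'⟩
  obtain rfl : e' = e := hx
  obtain rfl : e'' = e' := hy
  by_cases h : e'' ∈ A <;> by_cases t : G.twisted e'' <;>
    simp [edgePartner, Set.mem_symmDiff, h, t] <;> revert s b s' b' <;> decide

/-- A function on the marked points is constant on boundary components once it is constant on
gaps and on segments and sides. -/
theorem eq_of_boundaryArc {A : Set E} {β : Sort*} (F : G.BoundaryPoint → β)
    (hgap : ∀ x, F (Sum.inl (G.gapPartner x)) = F (Sum.inl x))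
    (hedge : ∀ x, F (Sum.inl (G.edgePartner A x)) = F (Sum.inl x))
    (p q : G.BoundaryPoint) (h : G.BoundaryArc A p q) : F p = F q := by
  cases h with
  | gap h => exact (hgap (h, true)).symm
  | segment h hA => simpa [edgePartner, hA] using (hedge (h, false)).symm
  | side e b hA => simpa [edgePartner, hA] using (hedge ((e, false), b)).symm

theorem cornerComponent_gapPartner (A : Set E) (x : (E × Bool) × Bool) :
    G.cornerComponent A (G.gapPartner x) = G.cornerComponent A x := by
  rcases x with ⟨h, _ | _⟩
  · have := Quot.sound (BoundaryArc.gap (G := G) (A := A) (G.next.symm h))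
    rw [Equiv.apply_symm_apply] at this
    exact this
  · exact (Quot.sound (BoundaryArc.gap h)).symm

theorem cornerComponent_edgePartner (A : Set E) (x : (E × Bool) × Bool) :
    G.cornerComponent A (G.edgePartner A x) = G.cornerComponent A x := by
  rcases x with ⟨⟨e, s⟩, b⟩
  by_cases h : e ∈ A
  · have side := fun b => Quot.sound (BoundaryArc.side (G := G) e b h)
    by_cases t : G.twisted e
    · simp only [t, if_true] at side
      simp only [edgePartner, cornerComponent, h, t, if_true]
      cases s
      · exact (side b).symm
      · exact side b
    · simp only [t, Bool.false_eq_true, if_false] at side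
      simp only [edgePartner, cornerComponent, h, t, Bool.false_eq_true, if_true, if_false]
      cases s
      · exact (side b).symm
      · have := side (!b)
        rw [Bool.not_not] at this
        exact this
  · have segment := Quot.sound (BoundaryArc.segment (G := G) (e, s) h)
    simp only [edgePartner, cornerComponent, h, if_false]
    cases b
    · exact segment.symm
    · exact segment

/-- The indicator of `P` is constant along arcs, so it descends to boundary components and separates
`x` from `y`. -/
theorem cornerComponent_ne_of_closed {A : Set E} (P : Set ((E × Bool) × Bool))
    (hgap : ∀ x ∈ P, G.gapPartner x ∈ P) (hedge : ∀ x ∈ P, G.edgePartner A x ∈ P)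
    {x y : (E × Bool) × Bool} (hx : x ∈ P) (hy : y ∉ P) :
    G.cornerComponent A x ≠ G.cornerComponent A y := by
  let F : G.BoundaryPoint → Prop := Sum.elim (· ∈ P) (fun _ => False)
  have hF := G.eq_of_boundaryArc (A := A) F
    (fun x => propext ⟨fun h => by simpa [F, gapPartner_gapPartner] using hgap _ h, hgap x⟩)
    (fun x => propext ⟨fun h => by simpa [F, edgePartner_edgePartner] using hedge _ h, hedge x⟩)
  intro h
  have := congrArg (Quot.lift F hF) h
  exact hy (this.mp hx)

/-- All corners of the edge disc `e` lie on one boundary component of `(V, A)`. -/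
def OneSided (A : Set E) (e : E) : Prop :=
  ∀ x y : (E × Bool) × Bool, x.1.1 = e → y.1.1 = e →
    G.cornerComponent A x = G.cornerComponent A y

/-- The arcs of `A` at `e` join its four corners in two pairs; the hypothesis links one pair to the
other. -/
theorem oneSided_of_edgePartner_toggle {A : Set E} {e : E} {x : (E × Bool) × Bool}
    (hx : x.1.1 = e)
    (h : G.cornerComponent A (G.edgePartner (A ∆ {e}) x) = G.cornerComponent A x) :
    G.OneSided A e := by
  have key : ∀ y : (E × Bool) × Bool, y.1.1 = e →
      G.cornerComponent A y = G.cornerComponent A x := by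
    intro y hy
    rcases G.corner_cases A hx hy with rfl | rfl | rfl | rfl
    · rfl
    · exact G.cornerComponent_edgePartner A x
    · exact h
    · rw [cornerComponent_edgePartner, h]
  exact fun y z hy hz => (key y hy).trans (key z hz).symm

/-- If every edge of `X ∆ Y` has all corners on one boundary component of `(V, X)`, then each
boundary component of `(V, Y)` is contained in one of `(V, X)`. -/
theorem boundaryArc_quot_eq {X Y : Set E} (h : ∀ e ∈ X ∆ Y, G.OneSided X e)
    (p q : G.BoundaryPoint) (hpq : G.BoundaryArc Y p q) :
    (Quot.mk (G.BoundaryArc X) p) = Quot.mk _ q := by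
  refine G.eq_of_boundaryArc (Quot.mk (G.BoundaryArc X)) (G.cornerComponent_gapPartner X)
    (fun x => ?_) p q hpq
  by_cases hx : x.1.1 ∈ X ∆ Y
  · exact h _ hx _ _ (G.edgePartner_edge Y x) rfl
  · rw [G.edgePartner_congr (A := Y) (B := X) (by rw [Set.mem_symmDiff] at hx; tauto)]
    exact G.cornerComponent_edgePartner X x

/-! ### Effect of toggling one edge on the number of boundary components -/

section Finite

variable [Finite E]

/-- Parity: otherwise `x` is the only corner of `e` on both its old and its new component. Gaps pair
up all corners common to the two components, while the arcs away from `e` pair up all of them but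
`x`. -/
theorem cornerComponent_toggle_of_not_oneSided {A : Set E} {e : E} (h : ¬ G.OneSided A e)
    {x : (E × Bool) × Bool} (hx : x.1.1 = e) :
    G.cornerComponent (A ∆ {e}) (G.edgePartner A x) = G.cornerComponent (A ∆ {e}) x := by
  classical
  by_contra hb
  have := Fintype.ofFinite E
  let s : Finset ((E × Bool) × Bool) := Finset.univ.filter fun y =>
    G.cornerComponent A y = G.cornerComponent A x ∧
      G.cornerComponent (A ∆ {e}) y = G.cornerComponent (A ∆ {e}) x
  have hs : ∀ y, y ∈ s ↔ G.cornerComponent A y = G.cornerComponent A x ∧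
      G.cornerComponent (A ∆ {e}) y = G.cornerComponent (A ∆ {e}) x := by simp [s]
  have hxs : x ∈ s := by simp [hs]
  have hother : ∀ y ∈ s, y ≠ x → y.1.1 ≠ e := by
    intro y hy hyx hye
    rw [hs] at hy
    rcases G.corner_cases A hx hye with rfl | rfl | rfl | rfl
    · exact hyx rfl
    · exact hb hy.2
    · exact h (G.oneSided_of_edgePartner_toggle hx hy.1)
    · rw [cornerComponent_edgePartner] at hy
      exact h (G.oneSided_of_edgePartner_toggle hx hy.1)
  have h1 : Even s.card := s.even_card_of_involution G.gapPartner
    (fun y hy => by simpa only [hs, cornerComponent_gapPartner] using hy)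
    (fun y _ => G.gapPartner_gapPartner y) (fun y _ => G.gapPartner_ne y)
  have h2 : Even (s.erase x).card := by
    refine (s.erase x).even_card_of_involution (G.edgePartner A) (fun y hy => ?_)
      (fun y _ => G.edgePartner_edgePartner A y) (fun y _ => G.edgePartner_ne A y)
    obtain ⟨hyx, hy⟩ := Finset.mem_erase.1 hy
    have hye := hother y hy hyx
    have hy' := (hs y).1 hy
    refine Finset.mem_erase.2 ⟨fun hc => hye ?_, (hs _).2 ⟨?_, ?_⟩⟩
    · rw [← G.edgePartner_edge A y, hc, hx]
    · rw [cornerComponent_edgePartner, hy'.1]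
    · rw [← G.edgePartner_toggle_of_ne hye, cornerComponent_edgePartner, hy'.2]
  have h3 := Finset.card_erase_add_one hxs
  rw [← h3, Nat.even_add_one] at h1
  exact h1 h2

theorem oneSided_toggle_of_not_oneSided {A : Set E} {e : E} (h : ¬ G.OneSided A e) :
    G.OneSided (A ∆ {e}) e := by
  have hx : (((e, false), false) : (E × Bool) × Bool).1.1 = e := rfl
  refine G.oneSided_of_edgePartner_toggle hx ?_
  rw [symmDiff_symmDiff_cancel_right]
  exact G.cornerComponent_toggle_of_not_oneSided h hx

variable [Finite V]

instance (A : Set E) : Finite (G.BoundaryComponent A) :=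
  Finite.of_surjective (Quot.mk _) Quot.mk_surjective

theorem numBoundary_le_of_oneSided {X Y : Set E} (h : ∀ e ∈ X ∆ Y, G.OneSided X e) :
    G.numBoundary X ≤ G.numBoundary Y :=
  Nat.card_le_card_of_surjective (Quot.lift (Quot.mk _) (G.boundaryArc_quot_eq h))
    (Quot.ind fun p => ⟨Quot.mk _ p, rfl⟩)

theorem numBoundary_toggle_lt {A : Set E} {e : E} (h : ¬ G.OneSided A e) :
    G.numBoundary (A ∆ {e}) < G.numBoundary A := by
  have h' := G.oneSided_toggle_of_not_oneSided h
  have hA : ∀ e' ∈ (A ∆ {e}) ∆ A, G.OneSided (A ∆ {e}) e' := by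
    intro e' he'
    rw [symmDiff_comm, symmDiff_symmDiff_cancel_left] at he'
    rwa [Set.mem_singleton_iff.1 he']
  refine lt_of_le_of_ne (G.numBoundary_le_of_oneSided hA) fun hcard => h ?_
  -- Equal counts would make merging components injective, so the corners of `e`, together after the
  -- toggle, would be together before it.
  have hbij : Function.Bijective (Quot.lift (Quot.mk _) (G.boundaryArc_quot_eq hA)) :=
    Function.Surjective.bijective_of_nat_card_le (Quot.ind fun p => ⟨Quot.mk _ p, rfl⟩) hcard.ge
  exact fun x y hx hy => hbij.1 (h' x y hx hy)

theorem numBoundary_le_toggle_add_one (A : Set E) (e : E) :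
    G.numBoundary A ≤ G.numBoundary (A ∆ {e}) + 1 := by
  classical
  let x : (E × Bool) × Bool := ((e, false), false)
  let a := G.cornerComponent A x
  let c := G.cornerComponent A (G.edgePartner (A ∆ {e}) x)
  -- At most two components of `A`, `a` and `c`, meet `e`. Once `c` is merged into `a`, the map
  -- descends to `A ∆ {e}` and can miss only `c`, which `none` supplies.
  let F : G.BoundaryPoint → G.BoundaryComponent A :=
    fun p => if Quot.mk _ p = c then a else Quot.mk _ p
  have hcorner : ∀ y : (E × Bool) × Bool, y.1.1 = e → F (Sum.inl y) = a := by
    intro y hy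
    change (if G.cornerComponent A y = c then a else G.cornerComponent A y) = a
    rcases G.corner_cases A (show x.1.1 = e from rfl) hy with rfl | rfl | rfl | rfl
    · simp [a]
    · simp [a, cornerComponent_edgePartner]
    · simp [c]
    · simp [c, cornerComponent_edgePartner]
  have hF : ∀ y z, G.cornerComponent A y = G.cornerComponent A z →
      F (Sum.inl y) = F (Sum.inl z) := by
    intro y z h
    change (if G.cornerComponent A y = c then a else G.cornerComponent A y) =
      (if G.cornerComponent A z = c then a else G.cornerComponent A z)
    rw [h]
  have hlift := G.eq_of_boundaryArc (A := A ∆ {e}) F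
    (fun y => hF _ _ (G.cornerComponent_gapPartner A y)) (fun y => by
      by_cases hy : y.1.1 = e
      · rw [hcorner y hy, hcorner _ ((G.edgePartner_edge _ y).trans hy)]
      · rw [G.edgePartner_toggle_of_ne hy]
        exact hF _ _ (G.cornerComponent_edgePartner A y))
  let g : Option (G.BoundaryComponent (A ∆ {e})) → G.BoundaryComponent A :=
    fun o => o.elim c (Quot.lift F hlift)
  have hg : Function.Surjective g := by
    refine Quot.ind fun p => ?_
    by_cases hp : Quot.mk _ p = c
    · exact ⟨none, hp.symm⟩
    · exact ⟨some (Quot.mk _ p), if_neg hp⟩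
  have := Nat.card_le_card_of_surjective g hg
  rwa [Finite.card_option] at this

theorem exists_numBoundary_toggle_lt {X Y : Set E} (h : G.numBoundary Y < G.numBoundary X) :
    ∃ e ∈ X ∆ Y, G.numBoundary (X ∆ {e}) < G.numBoundary X := by
  by_contra! hc
  exact h.not_ge (G.numBoundary_le_of_oneSided fun e he =>
    by_contra fun hn => (hc e he).not_gt (G.numBoundary_toggle_lt hn))

end Finite

/-! ### Boundary components against connected components -/

/-- The connected component on which a boundary component lies. -/
def boundaryToComponent (A : Set E) : G.BoundaryComponent A → G.Component A :=
  Quot.lift (fun p => Quot.mk _ (BoundaryPoint.vertex G p)) (by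
    intro p q h
    cases h with
    | gap h => exact congrArg _ (G.vert_next h).symm
    | segment h hA => rfl
    | side e b hA => exact Quot.sound ⟨e, hA, rfl, rfl⟩)

theorem exists_boundaryPoint_vertex (v : V) :
    ∃ p : G.BoundaryPoint, BoundaryPoint.vertex G p = v := by
  by_cases h : ∀ h, G.vert h ≠ v
  · exact ⟨Sum.inr ⟨v, h⟩, rfl⟩
  · push Not at h
    obtain ⟨h, rfl⟩ := h
    exact ⟨Sum.inl (h, false), rfl⟩

theorem boundaryToComponent_surjective (A : Set E) :
    Function.Surjective (G.boundaryToComponent A) := by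
  refine Quot.ind fun v => ?_
  obtain ⟨p, rfl⟩ := G.exists_boundaryPoint_vertex v
  exact ⟨Quot.mk _ p, rfl⟩

theorem liesOn_iff (A : Set E) (b : G.BoundaryComponent A) (c : G.Component A) :
    G.LiesOn A b c ↔ G.boundaryToComponent A b = c := by
  constructor
  · rintro ⟨p, rfl, rfl⟩
    rfl
  · rintro rfl
    obtain ⟨p, rfl⟩ := Quot.mk_surjective b
    exact ⟨p, rfl, rfl⟩

/-- Going around the vertex circle, one-sidedness crosses each segment and a gap leads to the next.
-/
theorem cornerComponent_eq_of_vert_eq [Finite E] {A : Set E} (h : ∀ e, G.OneSided A e)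
    {x y : (E × Bool) × Bool} (hxy : G.vert x.1 = G.vert y.1) :
    G.cornerComponent A x = G.cornerComponent A y := by
  have key : ∀ (n : ℕ) (t : E × Bool), G.cornerComponent A ((G.next ^ n) t, false) =
      G.cornerComponent A (t, false) := by
    intro n
    induction n with
    | zero => intro t; rfl
    | succ n ih =>
      intro t
      rw [pow_succ, Equiv.Perm.mul_apply, ih, h t.1 (t, false) (t, true) rfl rfl]
      exact G.cornerComponent_gapPartner A (t, true)
  obtain ⟨n, -, -, hn⟩ := ((G.vert_eq_iff _ _).1 hxy).exists_pow_eq''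
  rw [h x.1.1 x (x.1, false) rfl rfl, h y.1.1 y (y.1, false) rfl rfl, ← hn, key]

theorem boundaryComponent_eq_of_vertex_eq [Finite E] {A : Set E} (h : ∀ e, G.OneSided A e) :
    ∀ p q : G.BoundaryPoint, BoundaryPoint.vertex G p = BoundaryPoint.vertex G q →
      Quot.mk (G.BoundaryArc A) p = Quot.mk _ q
  | Sum.inl _, Sum.inl _, hpq => G.cornerComponent_eq_of_vert_eq h hpq
  | Sum.inl x, Sum.inr v, hpq => absurd hpq (v.2 x.1)
  | Sum.inr v, Sum.inl x, hpq => absurd hpq.symm (v.2 x.1)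
  | Sum.inr _, Sum.inr _, hpq => congrArg _ (congrArg _ (Subtype.ext hpq))

instance [Finite V] (A : Set E) : Finite (G.Component A) :=
  Finite.of_surjective (Quot.mk _) Quot.mk_surjective

theorem numComponents_univ_le [Finite V] (A : Set E) :
    G.numComponents Set.univ ≤ G.numComponents A :=
  Nat.card_le_card_of_surjective
    (Quot.lift (Quot.mk _) fun _ _ ⟨e, _, h⟩ => Quot.sound ⟨e, Set.mem_univ e, h⟩)
    (Quot.ind fun v => ⟨Quot.mk _ v, rfl⟩)

section Finite

variable [Finite V] [Finite E]

theorem numComponents_le_numBoundary (A : Set E) : G.numComponents A ≤ G.numBoundary A :=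
  Nat.card_le_card_of_surjective _ (G.boundaryToComponent_surjective A)

theorem numComponents_univ_le_numBoundary (A : Set E) :
    G.numComponents Set.univ ≤ G.numBoundary A :=
  (G.numComponents_univ_le A).trans (G.numComponents_le_numBoundary A)

theorem numBoundary_le_iff_isSpanningQuasiTree (A : Set E) :
    G.numBoundary A ≤ G.numComponents Set.univ ↔ G.IsSpanningQuasiTree A := by
  have h1 := G.numComponents_le_numBoundary A
  have h2 := G.numComponents_univ_le A
  simp only [IsSpanningQuasiTree, liesOn_iff, ← Function.bijective_iff_existsUnique]
  constructor
  · intro h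
    refine ⟨by omega, ?_⟩
    exact (G.boundaryToComponent_surjective A).bijective_of_nat_card_le (h.trans h2)
  · rintro ⟨h, hb⟩
    exact (Nat.card_congr (Equiv.ofBijective _ hb)).le.trans h.le

/-- Every ribbon graph has a spanning quasi-tree. -/
theorem exists_numBoundary_eq : ∃ A : Set E, G.numBoundary A = G.numComponents Set.univ := by
  -- At a minimum no toggle lowers `f`, so every edge is one-sided; all boundary points of a
  -- connected component of `G` then lie on one boundary component.
  obtain ⟨A, hA⟩ := Finite.exists_min G.numBoundary
  refine ⟨A, le_antisymm ?_ (G.numComponents_univ_le_numBoundary A)⟩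
  have hone : ∀ e, G.OneSided A e := fun e =>
    by_contra fun hn => (hA _).not_gt (G.numBoundary_toggle_lt hn)
  choose p hp using G.exists_boundaryPoint_vertex
  have hjoin : ∀ u v, G.JoinedBy Set.univ u v →
      Quot.mk (G.BoundaryArc A) (p u) = Quot.mk _ (p v) := by
    rintro _ _ ⟨e, -, rfl, rfl⟩
    have h1 := G.boundaryComponent_eq_of_vertex_eq hone (p (G.vert (e, false)))
      (Sum.inl ((e, false), false)) (hp _)
    have h2 := G.boundaryComponent_eq_of_vertex_eq hone (p (G.vert (e, true)))
      (Sum.inl ((e, true), false)) (hp _)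
    exact h1.trans ((hone e ((e, false), false) ((e, true), false) rfl rfl).trans h2.symm)
  refine Nat.card_le_card_of_surjective
    (Quot.lift (fun v => (Quot.mk _ (p v) : G.BoundaryComponent A)) hjoin) (Quot.ind fun q => ?_)
  exact ⟨Quot.mk _ (BoundaryPoint.vertex G q),
    G.boundaryComponent_eq_of_vertex_eq hone _ _ (hp _)⟩

theorem spread_isDeltaMatroid (n : ℕ) : (G.spread n).IsDeltaMatroid where
  finite := inferInstance
  proper := by
    obtain ⟨A, hA⟩ := G.exists_numBoundary_eq
    exact ⟨A, hA.le.trans (Nat.le_add_right _ _)⟩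
  exchange := by
    intro X (hX : G.numBoundary X ≤ _) Y (hY : G.numBoundary Y ≤ _) u hu
    by_cases h : G.numBoundary (X ∆ {u}) ≤ G.numComponents Set.univ + n
    · exact ⟨u, hu, by rwa [Set.pair_eq_singleton]⟩
    · obtain ⟨v, hv, hlt⟩ := G.exists_numBoundary_toggle_lt (X := X ∆ {u}) (Y := Y) (by omega)
      obtain ⟨hv, hvu⟩ := mem_symmDiff_of_mem_toggle_symmDiff hu hv
      refine ⟨v, hv, ?_⟩
      -- Toggling `u` overshoots the bound by at most one, so the drop at `v` repairs it.
      have h1 := G.numBoundary_le_toggle_add_one (X ∆ {u}) u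
      rw [symmDiff_symmDiff_cancel_right] at h1
      rw [toggle_toggle_of_ne X hvu] at hlt
      change G.numBoundary _ ≤ _
      omega

end Finite

/-! ### Orientable ribbon graphs and the 1-toggle -/

/-- Colouring the corners so that every arc of the boundary changes the colour. -/
theorem Orientable.exists_colouring {G : RibbonGraph V E} (h : G.Orientable) :
    ∃ col : (E × Bool) × Bool → Bool, (∀ x, col (G.gapPartner x) = !col x) ∧
      ∀ A x, col (G.edgePartner A x) = !col x := by
  obtain ⟨r, hr⟩ := h
  refine ⟨fun x => xor x.2 (r (G.vert x.1)), fun x => ?_, fun A x => ?_⟩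
  · simp only [gapPartner_snd, vert_gapPartner, Bool.not_xor]
  · rcases x with ⟨⟨e, s⟩, b⟩
    have he := hr e
    by_cases hA : e ∈ A
    · simp only [edgePartner, hA, if_true]
      cases s <;> simp only [Bool.not_false, Bool.not_true] <;> revert he <;>
        cases G.twisted e <;> cases r (G.vert (e, false)) <;> cases r (G.vert (e, true)) <;> cases b <;> decide
    · simp [edgePartner, hA]

/-- In an orientable ribbon graph the boundary arc leaving a corner `x` of `e` away from `e`
returns to `e` at a corner that is joined to `x` either before or after toggling `e`. -/
theorem Orientable.not_oneSided {G : RibbonGraph V E} [Finite E] (h : G.Orientable) (A : Set E)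
    (e : E) (h1 : G.OneSided A e) : ¬ G.OneSided (A ∆ {e}) e := by
  intro h2
  obtain ⟨col, hgap, hedge⟩ := h.exists_colouring
  let x : (E × Bool) × Bool := ((e, false), false)
  have hx : x.1.1 = e := rfl
  let step : (E × Bool) × Bool → (E × Bool) × Bool := fun y => G.edgePartner A (G.gapPartner y)
  have hstep : Function.Injective step :=
    (Function.Involutive.injective (G.edgePartner_edgePartner A)).comp
      (Function.Involutive.injective G.gapPartner_gapPartner)
  have hcol : ∀ j, col (step^[j] x) = col x := by
    intro j
    induction j with
    | zero => rfl
    | succ j ih => rw [Function.iterate_succ_apply', hedge, hgap, ih, Bool.not_not]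
  -- `step` permutes a finite set, so the walk returns to `x`, and its last arc before that is at
  -- `e`.
  have hret : ∃ j, (G.gapPartner (step^[j] x)).1.1 = e := by
    obtain ⟨m, hm, hper⟩ := Function.mem_periodicPts.1 (hstep.mem_periodicPts x)
    obtain ⟨j, rfl⟩ := Nat.exists_eq_succ_of_ne_zero hm.ne'
    refine ⟨j, ?_⟩
    have : step (step^[j] x) = x := by rw [← Function.iterate_succ_apply' step]; exact hper
    exact (G.edgePartner_edge A _).symm.trans (congrArg (·.1.1) this)
  classical
  let i := Nat.find hret
  have hi : (G.gapPartner (step^[i] x)).1.1 = e := Nat.find_spec hret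
  have hmin : ∀ j < i, (G.gapPartner (step^[j] x)).1.1 ≠ e := fun j hj => Nat.find_min hret hj
  -- The path from `x` to its first return to `e`. Its inner arcs avoid `e`, so they belong to both
  -- `A` and `A ∆ {e}`.
  let P : Set ((E × Bool) × Bool) :=
    {y | ∃ j ≤ i, y = step^[j] x ∨ y = G.gapPartner (step^[j] x)}
  have hxP : x ∈ P := ⟨0, Nat.zero_le _, Or.inl rfl⟩
  have hPgap : ∀ y ∈ P, G.gapPartner y ∈ P := by
    rintro _ ⟨j, hj, rfl | rfl⟩
    · exact ⟨j, hj, Or.inr rfl⟩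
    · exact ⟨j, hj, Or.inl (G.gapPartner_gapPartner _)⟩
  have hPends : ∀ y ∈ P, y.1.1 = e → y = x ∨ y = G.gapPartner (step^[i] x) := by
    rintro _ ⟨j, hj, rfl | rfl⟩ hy
    · rcases j with _ | j
      · exact Or.inl rfl
      · rw [Function.iterate_succ_apply', edgePartner_edge] at hy
        exact absurd hy (hmin j hj)
    · rcases hj.lt_or_eq with hj | rfl
      · exact absurd hy (hmin j hj)
      · exact Or.inr rfl
  have hPedge : ∀ y ∈ P, y.1.1 ≠ e → G.edgePartner A y ∈ P := by
    rintro _ ⟨j, hj, rfl | rfl⟩ hy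
    · rcases j with _ | j
      · exact absurd hx hy
      · refine ⟨j, (Nat.le_succ j).trans hj, Or.inr ?_⟩
        rw [Function.iterate_succ_apply']
        exact G.edgePartner_edgePartner A _
    · rcases hj.lt_or_eq with hj | rfl
      · exact ⟨j + 1, hj, Or.inl (Function.iterate_succ_apply' step j x).symm⟩
      · exact absurd hi hy
  -- The return corner has the colour opposite to `x`, which excludes `x` itself and the corner two
  -- arcs away.
  have hend : G.gapPartner (step^[i] x) = G.edgePartner A x ∨
      G.gapPartner (step^[i] x) = G.edgePartner (A ∆ {e}) x := by
    have hc : col (G.gapPartner (step^[i] x)) = !col x := by rw [hgap, hcol]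
    rcases G.corner_cases A hx hi with h | h | h | h
    · simp [h] at hc
    · exact Or.inl h
    · exact Or.inr h
    · simp [h, hedge] at hc
  have closed : ∀ B : Set E, (∀ y : (E × Bool) × Bool, y.1.1 ≠ e →
      G.edgePartner B y = G.edgePartner A y) → G.gapPartner (step^[i] x) = G.edgePartner B x →
      ∀ y ∈ P, G.edgePartner B y ∈ P := by
    intro B hB hBx y hy
    by_cases hye : y.1.1 = e
    · rcases hPends y hy hye with rfl | rfl
      · rw [← hBx]
        exact hPgap _ ⟨i, le_rfl, Or.inl rfl⟩
      · rw [hBx, edgePartner_edgePartner]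
        exact hxP
    · rw [hB y hye]
      exact hPedge y hy hye
  have hne := G.edgePartner_toggle_ne (A := A) hx
  -- In `A` or in `A ∆ {e}` the path closes up into a component with only two corners of `e`,
  -- against one-sidedness.
  rcases hend with hb | hb
  · refine G.cornerComponent_ne_of_closed P hPgap (closed A (fun _ _ => rfl) hb) hxP
      (y := G.edgePartner (A ∆ {e}) x) (fun hy => ?_) (h1 _ _ hx (G.edgePartner_edge _ _))
    rcases hPends _ hy (G.edgePartner_edge _ _) with h | h
    · exact G.edgePartner_ne _ _ h
    · exact hne (h.trans hb)
  · refine G.cornerComponent_ne_of_closed P hPgap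
      (closed (A ∆ {e}) (fun _ hy => G.edgePartner_toggle_of_ne hy) hb) hxP
      (y := G.edgePartner A x) (fun hy => ?_) (h2 _ _ hx (G.edgePartner_edge _ _))
    rcases hPends _ hy (G.edgePartner_edge _ _) with h | h
    · exact G.edgePartner_ne _ _ h
    · exact hne (h.trans hb).symm

section Finite

variable [Finite V] [Finite E]

/-- The edge fails to be one-sided on at least one side of the toggle, and toggling from there
lowers `f`. -/
theorem Orientable.numBoundary_toggle_ne {G : RibbonGraph V E} (h : G.Orientable) (A : Set E)
    (e : E) : G.numBoundary (A ∆ {e}) ≠ G.numBoundary A := by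
  by_cases h1 : G.OneSided A e
  · have := G.numBoundary_toggle_lt (h.not_oneSided A e h1)
    rw [symmDiff_symmDiff_cancel_right] at this
    exact this.ne'
  · exact (G.numBoundary_toggle_lt h1).ne

theorem Orientable.toggle_one_isDeltaMatroid {G : RibbonGraph V E} [Nonempty E]
    (h : G.Orientable) : (G.toggle 1).IsDeltaMatroid where
  finite := inferInstance
  proper := by
    obtain ⟨A, hA⟩ := G.exists_numBoundary_eq
    let e : E := Classical.arbitrary E
    refine ⟨A ∆ {e}, ?_⟩
    have h1 := h.numBoundary_toggle_ne A e
    have h2 := G.numBoundary_le_toggle_add_one (A ∆ {e}) e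
    have h3 := G.numComponents_univ_le_numBoundary (A ∆ {e})
    rw [symmDiff_symmDiff_cancel_right] at h2
    change G.numBoundary _ = _
    omega
  exchange := by
    intro X (hX : G.numBoundary X = _) Y (hY : G.numBoundary Y = _) u hu
    have key : ∃ v ∈ (X ∆ {u}) ∆ Y,
        G.numBoundary ((X ∆ {u}) ∆ {v}) = G.numComponents Set.univ + 1 := by
      have h1 := h.numBoundary_toggle_ne X u
      have h2 := G.numBoundary_le_toggle_add_one (X ∆ {u}) u
      rw [symmDiff_symmDiff_cancel_right] at h2
      rcases h1.lt_or_gt with hlt | hgt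
      -- Here `f(X ∆ {u}) = k(G)` is minimal, so any second toggle raises it to `k(G) + 1`; some `v`
      -- remains because `f(Y)` differs from `f(X ∆ {u})`.
      · have hne : ((X ∆ {u}) ∆ Y).Nonempty := by
          rw [Set.nonempty_iff_ne_empty]
          intro hempty
          rw [symmDiff_eq_bot.1 hempty] at hlt
          omega
        obtain ⟨v, hv⟩ := hne
        refine ⟨v, hv, ?_⟩
        have h3 := h.numBoundary_toggle_ne (X ∆ {u}) v
        have h4 := G.numBoundary_le_toggle_add_one ((X ∆ {u}) ∆ {v}) v
        have h5 := G.numComponents_univ_le_numBoundary ((X ∆ {u}) ∆ {v})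
        have h6 := G.numComponents_univ_le_numBoundary (X ∆ {u})
        rw [symmDiff_symmDiff_cancel_right] at h4
        omega
      -- Here `f(X ∆ {u}) = k(G) + 2`, and a lowering toggle drops it by exactly one.
      · obtain ⟨v, hv, hlt⟩ := G.exists_numBoundary_toggle_lt (hY.trans_lt (hX ▸ hgt))
        have h3 := G.numBoundary_le_toggle_add_one (X ∆ {u}) v
        exact ⟨v, hv, by omega⟩
    obtain ⟨v, hv, hf⟩ := key
    obtain ⟨hv, hvu⟩ := mem_symmDiff_of_mem_toggle_symmDiff hu hv
    rw [toggle_toggle_of_ne X hvu] at hf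
    exact ⟨v, hv, hf⟩

end Finite

end RibbonGraph

theorem theoremt1 {V E : Type*} [Finite V] [Finite E] (G : RibbonGraph V E) :
    (∀ n : ℕ, (G.spread n).IsDeltaMatroid) ∧
    (Nonempty E → G.Orientable → (G.toggle 1).IsDeltaMatroid) ∧
    (∀ A : Set E, A ∈ (G.spread 0).Feasible ↔ G.IsSpanningQuasiTree A) :=
  ⟨G.spread_isDeltaMatroid, fun _ h => h.toggle_one_isDeltaMatroid,
    G.numBoundary_le_iff_isSpanningQuasiTree⟩
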